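/- Let $n\ge 1$. A brick is a product of $n$ bounded intervals (possibly degenerate), and its volume $\lambda$ is the product of the lengths of these intervals. Let $T=[a_1,b_1]\times\cdots\times[a_n,b_n]$ be a closed brick, and let $\Sigma$ be the family of all closed bricks $[\alpha_1,\beta_1]\times\cdots\times[\alpha_n,\beta_n]$ with $a_i\le\alpha_i\le\beta_i\le b_i$ for $i=1,\dots,n$. For a closed brick $S$, a step function on $S$ is a finite linear combination $g=\sum_j c_j\chi_{S_j}$ of characteristic functions of bricks $S_j\subset S$, with integral $\int_S g=\sum_j c_j\lambda(S_j)$. A sequence $(g_m)$ of functions on $S$ converges nearly uniformly to $f:S\to\mathbb R$ if $(g_m)$ is uniformly bounded on $S$ and if for every $\delta>0$ there are finitely many bricks contained in $S$, of total volume less than $\delta$, such that $g_m\to f$ uniformly on the complement in $S$ of their union. A function $f:S\to\mathbb R$ is K-integrable if some sequence $(g_m)$ of step functions on $S$ converges nearly uniformly to it; then $\int_S f:=\lim_{m\to\infty}\int_S g_m$, where the limit exists and does not depend on the choice of the sequence. If $f:T\to\mathbb R$ is K-integrable, then $f|_S$ is K-integrable for every $S\in\Sigma$, and the indefinite integral of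 $f$ is the set function $S\mapsto\int_S f|_S$ on $\Sigma$. A set is a Jordan null set if for each $\varepsilon>0$ it can be covered by finitely many bricks of total volume less than $\varepsilon$. Let $\Psi:\Sigma\to\mathbb R$. It is strongly differentiable at a point $u$ of the interior of $T$ if there is $t\in\mathbb R$ such that for every $\varepsilon>0$ there is $\delta>0$ with $|\Psi(S)/\lambda(S)-t|<\varepsilon$ for every $S\in\Sigma$ satisfying $\lambda(S)>0$ and $S\subset B(u,\delta)$. For $\alpha\in\{-1,1\}^n$ it is strongly differentiable at $u$ in direction $\alpha$ if the same holds with the condition $S\subset B(u,\delta)$ replaced by $S\subset B(u,\delta)\cap\overline{T_{u,\alpha}}$, where $T_{u,\alpha}=I_1\times\cdots\times I_n$ with $I_k=[a_k,u_k)$ if $\alpha_k=-1$ and $I_k=(u_k,b_k]$ if $\alpha_k=1$. **Theorem.** A function $\Psi:\Sigma\to\mathbb R$ is the indefinite integral of some K-integrable function $f:T\to\mathbb R$ if and only if the following four conditions hold: 1. there exists $L>0$ such that $|\Psi(S)|\le L\lambda(S)$ for every $S\in\Sigma$; 2. $\Psi$ is finitely additive: $\Psi(S)=\sum_{i=1}^m\Psi(S_i)$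 whenever $S,S_1,\dots,S_m\in\Sigma$, $S=\bigcup_{i=1}^m S_i$, and the interiors of $S_i$ and $S_j$ are disjoint for $i\ne j$; 3. the set of points $u\in T$ at which $\Psi$ is not strongly differentiable is a Lebesgue null set; 4. the set of points $u\in T$ for which there is a direction $\alpha\in\{-1,1\}^n$ such that $\Psi$ is not strongly differentiable at $u$ in direction $\alpha$ is a Jordan null set. (In 3 and 4 the boundary points of $T$, where strong differentiability is not defined, are counted as exceptional points; they form a Jordan null set.) -/

import Mathlib

open Set Filter Topology MeasureTheory

noncomputable section

/-- A brick in `ℝⁿ`: a product of `n` bounded intervals (open, closed, half-open or degenerate). -/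
structure Brick (n : ℕ) where
  side : Fin n → Set ℝ
  ordConnected_side : ∀ i, (side i).OrdConnected
  isBounded_side : ∀ i, Bornology.IsBounded (side i)

namespace Brick

/-- The set of points of a brick. -/
def toSet {n : ℕ} (P : Brick n) : Set (Fin n → ℝ) := Set.univ.pi P.side

/-- The volume of a brick: the product of the lengths of its sides. -/
def vol {n : ℕ} (P : Brick n) : ℝ := ∏ i, volume.real (P.side i)

end Brick

/-- The closed bricks `[α₁, β₁] × ⋯ × [αₙ, βₙ]` with `αᵢ ≤ βᵢ`.  As a set, such a brick is
`Set.Icc α β`, and `S ≤ T` says that `S` is contained in `T`. -/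
abbrev ClosedBrick (n : ℕ) : Type := NonemptyInterval (Fin n → ℝ)

namespace ClosedBrick

/-- A closed brick, seen as a brick. -/
def toBrick {n : ℕ} (S : ClosedBrick n) : Brick n where
  side i := Set.Icc (S.fst i) (S.snd i)
  ordConnected_side _ := Set.ordConnected_Icc
  isBounded_side _ := Metric.isBounded_Icc _ _

/-- The volume of a closed brick. -/
def vol {n : ℕ} (S : ClosedBrick n) : ℝ := S.toBrick.vol

theorem toSet_toBrick {n : ℕ} (S : ClosedBrick n) :
    S.toBrick.toSet = (S : Set (Fin n → ℝ)) := by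
  ext x
  simp [Brick.toSet, toBrick, NonemptyInterval.coe_def, Pi.le_def]

theorem vol_eq {n : ℕ} (S : ClosedBrick n) : S.vol = ∏ i, (S.snd i - S.fst i) := by
  unfold vol Brick.vol
  refine Finset.prod_congr rfl fun i _ => ?_
  exact Real.volume_real_Icc_of_le (S.fst_le_snd i)

end ClosedBrick

/-- The family of all closed bricks contained in the closed brick `T`. -/
abbrev SubBrick {n : ℕ} (T : ClosedBrick n) : Type := {S : ClosedBrick n // S ≤ T}

/-- A step function on `T`, given as a finite linear combination of characteristic functions of
bricks contained in `T`. -/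
structure StepFunction {n : ℕ} (T : Set (Fin n → ℝ)) where
  M : ℕ
  coeff : Fin M → ℝ
  brick : Fin M → Brick n
  brick_subset : ∀ j, (brick j).toSet ⊆ T

namespace StepFunction

/-- The function `∑ⱼ cⱼ χ_{Tⱼ}`. -/
def toFun {n : ℕ} {T : Set (Fin n → ℝ)} (g : StepFunction T) (x : Fin n → ℝ) : ℝ :=
  ∑ j, (g.brick j).toSet.indicator (fun _ => g.coeff j) x

/-- The integral `∑ⱼ cⱼ λ(Tⱼ)`. -/
def integral {n : ℕ} {T : Set (Fin n → ℝ)} (g : StepFunction T) : ℝ :=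
  ∑ j, g.coeff j * (g.brick j).vol

end StepFunction

/-- Nearly uniform convergence on `T`.  Functions on `T` are represented by functions on `ℝⁿ`;
their values outside `T` play no role. -/
def NearlyUniform {n : ℕ} (T : Set (Fin n → ℝ)) (g : ℕ → (Fin n → ℝ) → ℝ)
    (f : (Fin n → ℝ) → ℝ) : Prop :=
  (∃ C : ℝ, ∀ m, ∀ x ∈ T, |g m x| ≤ C) ∧
  ∀ δ : ℝ, 0 < δ → ∃ (N : ℕ) (P : Fin N → Brick n),
    (∀ j, (P j).toSet ⊆ T) ∧ ∑ j, (P j).vol < δ ∧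
      TendstoUniformlyOn g f atTop (T \ ⋃ j, (P j).toSet)

/-- `f` is K-integrable on `T`: some sequence of step functions on `T` converges nearly uniformly
to `f`. -/
def KIntegrableOn {n : ℕ} (T : Set (Fin n → ℝ)) (f : (Fin n → ℝ) → ℝ) : Prop :=
  ∃ g : ℕ → StepFunction T, NearlyUniform T (fun m => (g m).toFun) f

/-- `f` is K-integrable on `T` and its K-integral over `T` is `I`: the integrals of the step
functions tend to `I` for every sequence of step functions converging nearly uniformly to `f`. -/
def HasKIntegralOn {n : ℕ} (T : Set (Fin n → ℝ)) (f : (Fin n → ℝ) → ℝ) (I : ℝ) : Prop :=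
  KIntegrableOn T f ∧
  ∀ g : ℕ → StepFunction T, NearlyUniform T (fun m => (g m).toFun) f →
    Tendsto (fun m => (g m).integral) atTop (𝓝 I)

/-- `Ψ` is the indefinite integral of the K-integrable function `f` on `T`. -/
def IsIndefiniteKIntegral {n : ℕ} (T : ClosedBrick n) (f : (Fin n → ℝ) → ℝ)
    (Ψ : SubBrick T → ℝ) : Prop :=
  KIntegrableOn (T : Set (Fin n → ℝ)) f ∧
  ∀ S : SubBrick T, HasKIntegralOn (S.1 : Set (Fin n → ℝ)) f (Ψ S)

/-- A Jordan null set: for each `ε > 0` it is covered by finitely many bricks of total volume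
less than `ε`. -/
def JordanNull {n : ℕ} (A : Set (Fin n → ℝ)) : Prop :=
  ∀ ε : ℝ, 0 < ε → ∃ (N : ℕ) (P : Fin N → Brick n),
    A ⊆ (⋃ j, (P j).toSet) ∧ ∑ j, (P j).vol < ε

/-- The Lipschitz property of a set function. -/
def IsLipschitz {n : ℕ} {T : ClosedBrick n} (Ψ : SubBrick T → ℝ) : Prop :=
  ∃ L : ℝ, 0 < L ∧ ∀ S : SubBrick T, |Ψ S| ≤ L * S.1.vol

/-- Finite additivity over decompositions into non-overlapping closed bricks. -/
def IsFinitelyAdditive {n : ℕ} {T : ClosedBrick n} (Ψ : SubBrick T → ℝ) : Prop :=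
  ∀ (S : SubBrick T) (m : ℕ) (P : Fin m → SubBrick T),
    (S.1 : Set (Fin n → ℝ)) = ⋃ i, ((P i).1 : Set (Fin n → ℝ)) →
    (∀ i j, i ≠ j → Disjoint (interior ((P i).1 : Set (Fin n → ℝ)))
      (interior ((P j).1 : Set (Fin n → ℝ)))) →
    Ψ S = ∑ i, Ψ (P i)

/-- `Ψ` is strongly differentiable at the interior point `u` of `T`, with strong derivative `t`.
The balls of `Fin n → ℝ` are those of the maximum norm, which give the same notion as the
Euclidean balls. -/
def HasStrongDerivAt {n : ℕ} {T : ClosedBrick n} (Ψ : SubBrick T → ℝ) (u : Fin n → ℝ)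
    (t : ℝ) : Prop :=
  u ∈ interior (T : Set (Fin n → ℝ)) ∧
  ∀ ε : ℝ, 0 < ε → ∃ δ : ℝ, 0 < δ ∧ ∀ S : SubBrick T, 0 < S.1.vol →
    (S.1 : Set (Fin n → ℝ)) ⊆ Metric.ball u δ → |Ψ S / S.1.vol - t| < ε

/-- The brick `T_{u,α}` for a diagonal direction `α ∈ {-1, 1}ⁿ` (`ℤˣ` consists of `1` and `-1`):
its `k`-th side is `(u_k, b_k]` if `α_k = 1` and `[a_k, u_k)` if `α_k = -1`. -/
def directionalPart {n : ℕ} (T : ClosedBrick n) (u : Fin n → ℝ) (α : Fin n → ℤˣ) :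
    Set (Fin n → ℝ) :=
  Set.univ.pi fun k => if α k = 1 then Set.Ioc (u k) (T.snd k) else Set.Ico (T.fst k) (u k)

/-- `Ψ` is strongly differentiable at the interior point `u` of `T` in the direction `α`, with
strong derivative `t`. -/
def HasStrongDerivInDirAt {n : ℕ} {T : ClosedBrick n} (Ψ : SubBrick T → ℝ) (u : Fin n → ℝ)
    (α : Fin n → ℤˣ) (t : ℝ) : Prop :=
  u ∈ interior (T : Set (Fin n → ℝ)) ∧
  ∀ ε : ℝ, 0 < ε → ∃ δ : ℝ, 0 < δ ∧ ∀ S : SubBrick T, 0 < S.1.vol →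
    (S.1 : Set (Fin n → ℝ)) ⊆ Metric.ball u δ ∩ closure (directionalPart T u α) →
      |Ψ S / S.1.vol - t| < ε

end

/-! On bricks the K-integral is the Lebesgue integral: nearly uniform convergence is bounded
convergence almost everywhere, so dominated convergence applies, and `hasKIntegralOn_iff` reduces
the rest to Lebesgue integrals plus K-integrability.

Necessity. Bounds and additivity are inherited from the integral. Off a Jordan null set the
approximating step functions converge uniformly near `u` (`NearlyUniform.jordanNull`). A step
function is constant near `u` inside each open orthant at `u`, so its uniform limit `f` has a limit
at `u` in every direction, and the averages of `f` over small bricks in that orthant tend to this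
limit. If `u` also avoids the boundaries of the countably many bricks involved, the full limit
exists; those boundaries form only a Lebesgue null set, whence the two different kinds of
exceptional set.

Sufficiency. The candidate is `cornerDeriv`, the derivative in direction (1, …, 1), which exists off
a Jordan null set, whereas the strong derivative is only known to exist off a Lebesgue null set. A
small brick with lowest corner `x` lies in the closed orthant at `u` that corresponds to the
position of `x`, where ties `x k = u k` count as positive. So near `u` the corner derivative is
almost constant on each of the 2ⁿ half-open orthants (`HasStrongDerivInDirAt.exists_abs_sub_lt`). On
compact sets, finitely many such orthant pieces give a uniform step approximation
(`exists_step_approximation`), hence K-integrability. Finally, the averages of `Ψ` over finer and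
finer grids tend almost everywhere to the strong derivative and have integral exactly `Ψ S` by
additivity (`setIntegral_eq_of_ae_hasStrongDerivAt`). -/

namespace Brick

/-! ### Bricks and their Lebesgue measure. -/

variable {n : ℕ}

theorem measurableSet_toSet (P : Brick n) : MeasurableSet P.toSet :=
  MeasurableSet.univ_pi fun i => (P.ordConnected_side i).measurableSet

theorem convex_toSet (P : Brick n) : Convex ℝ P.toSet :=
  convex_pi fun i _ => (P.ordConnected_side i).convex

theorem isBounded_toSet (P : Brick n) : Bornology.IsBounded P.toSet :=
  Bornology.IsBounded.pi P.isBounded_side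

theorem volume_toSet_ne_top (P : Brick n) : volume P.toSet ≠ ⊤ :=
  P.isBounded_toSet.measure_lt_top.ne

theorem volume_real_toSet (P : Brick n) : volume.real P.toSet = P.vol := by
  simp [Measure.real, toSet, vol, volume_pi_pi, ENNReal.toReal_prod]

theorem volume_toSet (P : Brick n) : volume P.toSet = ENNReal.ofReal P.vol := by
  rw [← volume_real_toSet, ofReal_measureReal P.volume_toSet_ne_top]

theorem vol_nonneg (P : Brick n) : 0 ≤ P.vol :=
  Finset.prod_nonneg fun _ _ => measureReal_nonneg

/-- The intersection of two bricks. -/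
def inter (P Q : Brick n) : Brick n where
  side i := P.side i ∩ Q.side i
  ordConnected_side i := (P.ordConnected_side i).inter (Q.ordConnected_side i)
  isBounded_side i := (P.isBounded_side i).subset inter_subset_left

theorem toSet_inter (P Q : Brick n) : (P.inter Q).toSet = P.toSet ∩ Q.toSet :=
  pi_inter_distrib

theorem vol_inter_le (P Q : Brick n) : (P.inter Q).vol ≤ P.vol := by
  rw [← volume_real_toSet, ← volume_real_toSet, toSet_inter]
  exact measureReal_mono inter_subset_left P.volume_toSet_ne_top

/-- Each side is replaced by `[inf - s, sup + s]`; the volume depends continuously on `s`, so a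
small `s > 0` suffices. -/
theorem exists_isClosed_superset (P : Brick n) {η : ℝ} (hη : 0 < η) :
    ∃ Q : Brick n, IsClosed Q.toSet ∧ P.toSet ⊆ interior Q.toSet ∧ Q.vol < P.vol + η := by
  -- An empty brick serves as its own enlargement; its sides may have no meaningful infimum.
  rcases P.toSet.eq_empty_or_nonempty with h | ⟨x, hx⟩
  · exact ⟨P, by simp [h], by simp [h], by linarith⟩
  have hlim : Tendsto (fun s : ℝ => ∏ i, (volume.real (P.side i) + 2 * s)) (𝓝[>] 0)
      (𝓝 P.vol) := by
    have : ContinuousAt (fun s : ℝ => ∏ i, (volume.real (P.side i) + 2 * s)) 0 := by fun_prop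
    simpa [ContinuousAt, vol] using this.tendsto.mono_left (nhdsWithin_le_nhds (s := Ioi 0))
  obtain ⟨s, hs, hs0⟩ :=
    ((hlim.eventually_lt_const (by linarith : P.vol < P.vol + η)).and self_mem_nhdsWithin).exists
  have hs0 : 0 < s := hs0
  have hbb i : BddBelow (P.side i) := (P.isBounded_side i).bddBelow
  have hba i : BddAbove (P.side i) := (P.isBounded_side i).bddAbove
  have hle i : sInf (P.side i) ≤ sSup (P.side i) :=
    (csInf_le (hbb i) (hx i trivial)).trans (le_csSup (hba i) (hx i trivial))
  have hvol i : sSup (P.side i) - sInf (P.side i) ≤ volume.real (P.side i) := by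
    have hsub : Ioo (sInf (P.side i)) (sSup (P.side i)) ⊆ P.side i := by
      rintro y ⟨h1, h2⟩
      obtain ⟨p, hp, hpy⟩ := exists_lt_of_csInf_lt ⟨x i, hx i trivial⟩ h1
      obtain ⟨q, hq, hyq⟩ := exists_lt_of_lt_csSup ⟨x i, hx i trivial⟩ h2
      exact (P.ordConnected_side i).out hp hq ⟨hpy.le, hyq.le⟩
    have := measureReal_mono hsub (μ := volume) (P.isBounded_side i).measure_lt_top.ne
    rwa [Real.volume_real_Ioo_of_le (hle i)] at this
  refine ⟨⟨fun i => Icc (sInf (P.side i) - s) (sSup (P.side i) + s), fun _ => ordConnected_Icc,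
    fun _ => Metric.isBounded_Icc _ _⟩, isClosed_set_pi fun i _ => isClosed_Icc, ?_, ?_⟩
  · intro y hy
    rw [toSet, interior_pi_set finite_univ]
    intro i _
    simp only [interior_Icc]
    have h1 := csInf_le (hbb i) (hy i trivial)
    have h2 := le_csSup (hba i) (hy i trivial)
    constructor <;> linarith
  · refine lt_of_le_of_lt ?_ hs
    refine Finset.prod_le_prod (fun _ _ => measureReal_nonneg) fun i _ => ?_
    have := hle i
    have := hvol i
    rw [Real.volume_real_Icc_of_le (by linarith)]
    linarith

end Brick

namespace ClosedBrick

variable {n : ℕ}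

theorem measurableSet_coe (S : ClosedBrick n) : MeasurableSet (S : Set (Fin n → ℝ)) :=
  S.toSet_toBrick ▸ S.toBrick.measurableSet_toSet

theorem volume_coe_ne_top (S : ClosedBrick n) : volume (S : Set (Fin n → ℝ)) ≠ ⊤ :=
  S.toSet_toBrick ▸ S.toBrick.volume_toSet_ne_top

theorem volume_real_coe (S : ClosedBrick n) : volume.real (S : Set (Fin n → ℝ)) = S.vol := by
  rw [← S.toSet_toBrick, Brick.volume_real_toSet, vol]

theorem vol_nonneg (S : ClosedBrick n) : 0 ≤ S.vol := S.toBrick.vol_nonneg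

theorem volume_frontier (S : ClosedBrick n) : volume (frontier (S : Set (Fin n → ℝ))) = 0 := by
  rw [← S.toSet_toBrick]
  exact S.toBrick.convex_toSet.addHaar_frontier volume

theorem isCompact_coe (S : ClosedBrick n) : IsCompact (S : Set (Fin n → ℝ)) := by
  rw [NonemptyInterval.coe_def]
  exact isCompact_Icc

theorem interior_coe (S : ClosedBrick n) :
    interior (S : Set (Fin n → ℝ)) = Set.univ.pi fun i => Ioo (S.fst i) (S.snd i) := by
  rw [NonemptyInterval.coe_def, ← pi_univ_Icc, interior_pi_set finite_univ]
  simp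

theorem coe_subset_coe {S T : ClosedBrick n} (h : S ≤ T) :
    (S : Set (Fin n → ℝ)) ⊆ (T : Set (Fin n → ℝ)) := by
  exact NonemptyInterval.coe_subset_coe.mpr h

end ClosedBrick

/-! ### The algebra of step functions. -/

/-- `h` is the function of a step function on `T`. -/
def IsStep {n : ℕ} (T : Set (Fin n → ℝ)) (h : (Fin n → ℝ) → ℝ) : Prop :=
  ∃ g : StepFunction T, g.toFun = h

namespace IsStep

variable {n : ℕ} {T : Set (Fin n → ℝ)}

theorem of_fintype {ι : Type*} [Fintype ι] (c : ι → ℝ) (P : ι → Brick n)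
    (hP : ∀ i, (P i).toSet ⊆ T) :
    IsStep T fun x => ∑ i, (P i).toSet.indicator (fun _ => c i) x := by
  let e := Fintype.equivFin ι
  refine ⟨⟨Fintype.card ι, fun j => c (e.symm j), fun j => P (e.symm j), fun j => hP _⟩, ?_⟩
  funext x
  exact Equiv.sum_comp e.symm fun i => (P i).toSet.indicator (fun _ => c i) x

theorem zero : IsStep T 0 := by
  convert of_fintype (T := T) (ι := Empty) (fun _ => 0) (fun i => i.elim) (fun i => i.elim) using 1
  ext; simp

theorem add {g h : (Fin n → ℝ) → ℝ} (hg : IsStep T g) (hh : IsStep T h) : IsStep T (g + h) := by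
  obtain ⟨g, rfl⟩ := hg
  obtain ⟨h, rfl⟩ := hh
  convert of_fintype (T := T) (ι := Fin g.M ⊕ Fin h.M) (Sum.elim g.coeff h.coeff)
    (Sum.elim g.brick h.brick) (by
      rintro (i | i)
      exacts [g.brick_subset i, h.brick_subset i]) using 1
  ext x
  simp [StepFunction.toFun]

theorem neg {g : (Fin n → ℝ) → ℝ} (hg : IsStep T g) : IsStep T (-g) := by
  obtain ⟨g, rfl⟩ := hg
  convert of_fintype (T := T) (-g.coeff) g.brick g.brick_subset using 1
  ext x
  simp only [Pi.neg_apply, StepFunction.toFun, ← Finset.sum_neg_distrib]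
  refine Finset.sum_congr rfl fun i _ => ?_
  by_cases h : x ∈ (g.brick i).toSet <;> simp [h]

theorem const {P : Brick n} (hP : P.toSet ⊆ T) (c : ℝ) :
    IsStep T (P.toSet.indicator fun _ => c) := by
  convert of_fintype (T := T) (ι := Unit) (fun _ => c) (fun _ => P) (fun _ => hP) using 1
  ext; simp

theorem indicator_inter {g : (Fin n → ℝ) → ℝ} (hg : IsStep T g) (P : Brick n) :
    IsStep (T ∩ P.toSet) (P.toSet.indicator g) := by
  obtain ⟨g, rfl⟩ := hg
  convert of_fintype (T := T ∩ P.toSet) g.coeff (fun j => (g.brick j).inter P) (fun j => by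
    rw [Brick.toSet_inter]
    exact inter_subset_inter_left _ (g.brick_subset j)) using 1
  ext x
  simp_rw [Brick.toSet_inter]
  by_cases h : x ∈ P.toSet
  · simp only [h, indicator_of_mem, StepFunction.toFun]
    refine Finset.sum_congr rfl fun j _ => ?_
    by_cases hj : x ∈ (g.brick j).toSet <;> simp [h, hj]
  · simp [h]

theorem mono {T' : Set (Fin n → ℝ)} (hT : T ⊆ T') {g : (Fin n → ℝ) → ℝ} (hg : IsStep T g) :
    IsStep T' g := by
  obtain ⟨g, rfl⟩ := hg
  exact ⟨⟨g.M, g.coeff, g.brick, fun j => (g.brick_subset j).trans hT⟩, rfl⟩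

open Classical in
theorem piecewise_const {g : (Fin n → ℝ) → ℝ} (hg : IsStep T g) {P : Brick n}
    (hP : P.toSet ⊆ T) (c : ℝ) : IsStep T (P.toSet.piecewise (fun _ => c) g) := by
  convert (hg.add (const hP c)).add ((hg.indicator_inter P).mono inter_subset_left).neg using 1
  ext x
  by_cases h : x ∈ P.toSet <;> simp [h]

end IsStep

namespace StepFunction

variable {n : ℕ} {T : Set (Fin n → ℝ)}

theorem measurable_toFun (g : StepFunction T) : Measurable g.toFun :=
  Finset.measurable_sum _ fun j _ => measurable_const.indicator (g.brick j).measurableSet_toSet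

theorem setIntegral_toFun (g : StepFunction T) : ∫ x in T, g.toFun x = g.integral := by
  unfold toFun integral
  rw [integral_finsetSum]
  · refine Finset.sum_congr rfl fun j _ => ?_
    rw [integral_indicator (g.brick j).measurableSet_toSet, setIntegral_const,
      measureReal_restrict_apply (g.brick j).measurableSet_toSet,
      inter_eq_left.mpr (g.brick_subset j), Brick.volume_real_toSet, smul_eq_mul, mul_comm]
  · intro j _
    refine IntegrableOn.integrable_indicator ?_ (g.brick j).measurableSet_toSet
    refine integrableOn_const ?_
    refine ((Measure.restrict_apply_le _ _).trans_lt ?_).ne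
    exact (g.brick j).volume_toSet_ne_top.lt_top

end StepFunction

/-! ### Nearly uniform convergence and the K-integral as a Lebesgue integral. -/

namespace NearlyUniform

variable {n : ℕ} {T : Set (Fin n → ℝ)} {g : ℕ → (Fin n → ℝ) → ℝ} {f : (Fin n → ℝ) → ℝ}

/-- The points of non-convergence are covered by bricks of total volume less than any given `ε`. -/
theorem ae_tendsto (h : NearlyUniform T g f) (hT : MeasurableSet T) :
    ∀ᵐ x ∂volume.restrict T, Tendsto (fun m => g m x) atTop (𝓝 (f x)) := by
  rw [ae_restrict_iff' hT]
  refine le_antisymm (ENNReal.le_of_forall_pos_le_add fun ε hε _ => ?_) zero_le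
  obtain ⟨N, P, -, hsum, hunif⟩ := h.2 ε hε
  rw [zero_add]
  calc
    _ ≤ volume (⋃ j, (P j).toSet) := by
      refine measure_mono fun x hx => ?_
      by_contra hxU
      refine hx fun hxT => ?_
      exact hunif.tendsto_at ⟨hxT, hxU⟩
    _ ≤ ∑ j, volume (P j).toSet := measure_iUnion_fintype_le _ _
    _ = ENNReal.ofReal (∑ j, (P j).vol) := by
      simp_rw [Brick.volume_toSet]
      rw [ENNReal.ofReal_sum_of_nonneg fun j _ => (P j).vol_nonneg]
    _ ≤ ε := by
      rw [← ENNReal.ofReal_coe_nnreal]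
      exact ENNReal.ofReal_le_ofReal hsum.le

theorem restrict (h : NearlyUniform T g f) (S : Brick n) (hS : S.toSet ⊆ T) :
    NearlyUniform S.toSet (fun m => S.toSet.indicator (g m)) f := by
  obtain ⟨⟨C, hC⟩, h⟩ := h
  refine ⟨⟨C, fun m x hx => by simpa [hx] using hC m x (hS hx)⟩, fun δ hδ => ?_⟩
  obtain ⟨N, P, -, hsum, hunif⟩ := h δ hδ
  refine ⟨N, fun j => (P j).inter S, fun j => ?_, ?_, ?_⟩
  · rw [Brick.toSet_inter]
    exact inter_subset_right
  · exact (Finset.sum_le_sum fun j _ => (P j).vol_inter_le S).trans_lt hsum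
  · refine (hunif.mono (s' := S.toSet \ ⋃ j, ((P j).inter S).toSet) ?_).congr
      (.of_forall fun m x hx => ?_)
    · rintro x ⟨hx, hxP⟩
      refine ⟨hS hx, fun hxU => hxP ?_⟩
      simp only [Brick.toSet_inter, mem_iUnion, mem_inter_iff] at hxU ⊢
      exact hxU.imp fun j hj => ⟨hj, hx⟩
    · simp [hx.1]

end NearlyUniform

section KIntegral

variable {n : ℕ} {T : Set (Fin n → ℝ)} {f : (Fin n → ℝ) → ℝ}

/-- Dominated convergence with the uniform bound as dominating constant; the limit does not involve
the sequence. -/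
theorem NearlyUniform.tendsto_integral {g : ℕ → StepFunction T}
    (h : NearlyUniform T (fun m => (g m).toFun) f) (hT : MeasurableSet T) (hT' : volume T ≠ ⊤) :
    Tendsto (fun m => (g m).integral) atTop (𝓝 (∫ x in T, f x)) := by
  obtain ⟨C, hC⟩ := h.1
  simp_rw [← StepFunction.setIntegral_toFun]
  refine tendsto_integral_of_dominated_convergence (fun _ => C)
    (fun m => (g m).measurable_toFun.aestronglyMeasurable) (integrableOn_const hT') (fun m => ?_)
    (h.ae_tendsto hT)
  filter_upwards [ae_restrict_mem hT] with x hx using hC m x hx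

theorem hasKIntegralOn_iff (hT : MeasurableSet T) (hT' : volume T ≠ ⊤) {I : ℝ} :
    HasKIntegralOn T f I ↔ KIntegrableOn T f ∧ I = ∫ x in T, f x := by
  refine and_congr_right fun ⟨g, hg⟩ => ⟨fun h => ?_, fun h g' hg' => ?_⟩
  · exact tendsto_nhds_unique (h g hg) (hg.tendsto_integral hT hT')
  · exact h ▸ hg'.tendsto_integral hT hT'

theorem KIntegrableOn.aestronglyMeasurable (h : KIntegrableOn T f) (hT : MeasurableSet T) :
    AEStronglyMeasurable f (volume.restrict T) := by
  obtain ⟨g, hg⟩ := h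
  exact aestronglyMeasurable_of_tendsto_ae atTop
    (fun m => (g m).measurable_toFun.aestronglyMeasurable) (hg.ae_tendsto hT)

theorem KIntegrableOn.exists_bound (h : KIntegrableOn T f) (hT : MeasurableSet T) :
    ∃ C, ∀ᵐ x ∂volume.restrict T, ‖f x‖ ≤ C := by
  obtain ⟨g, hg⟩ := h
  obtain ⟨C, hC⟩ := hg.1
  refine ⟨C, ?_⟩
  filter_upwards [hg.ae_tendsto hT, ae_restrict_mem hT] with x hx hxT
  exact le_of_tendsto hx.norm (.of_forall fun m => hC m x hxT)

theorem KIntegrableOn.integrableOn (h : KIntegrableOn T f) (hT : MeasurableSet T)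
    (hT' : volume T ≠ ⊤) : IntegrableOn f T := by
  obtain ⟨C, hC⟩ := h.exists_bound hT
  exact .of_bound hT'.lt_top (h.aestronglyMeasurable hT) C hC

theorem KIntegrableOn.mono_brick (h : KIntegrableOn T f) (S : Brick n) (hS : S.toSet ⊆ T) :
    KIntegrableOn S.toSet f := by
  obtain ⟨g, hg⟩ := h
  have key m : IsStep S.toSet (S.toSet.indicator (g m).toFun) := by
    have : IsStep T (g m).toFun := ⟨g m, rfl⟩
    simpa [inter_eq_right.mpr hS] using this.indicator_inter S
  choose g' hg' using key
  refine ⟨g', ?_⟩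
  simp_rw [hg']
  exact hg.restrict S hS

end KIntegral

/-! ### Jordan null sets. -/

section JordanNull

variable {n : ℕ}

theorem JordanNull.mono {A B : Set (Fin n → ℝ)} (hB : JordanNull B) (h : A ⊆ B) :
    JordanNull A := fun ε hε =>
  let ⟨N, P, hP, hsum⟩ := hB ε hε
  ⟨N, P, h.trans hP, hsum⟩

theorem JordanNull.of_fintype {A : Set (Fin n → ℝ)}
    (h : ∀ ε : ℝ, 0 < ε → ∃ (ι : Type) (_ : Fintype ι) (P : ι → Brick n),
      A ⊆ (⋃ j, (P j).toSet) ∧ ∑ j, (P j).vol < ε) : JordanNull A := by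
  intro ε hε
  obtain ⟨ι, _, P, hP, hsum⟩ := h ε hε
  let e := Fintype.equivFin ι
  refine ⟨Fintype.card ι, fun j => P (e.symm j), ?_, ?_⟩
  · rwa [e.symm.surjective.iUnion_comp fun j => (P j).toSet]
  · rwa [Equiv.sum_comp e.symm fun j => (P j).vol]

theorem JordanNull.union {A B : Set (Fin n → ℝ)} (hA : JordanNull A) (hB : JordanNull B) :
    JordanNull (A ∪ B) := by
  refine .of_fintype fun ε hε => ?_
  obtain ⟨N, P, hP, hPsum⟩ := hA (ε / 2) (half_pos hε)
  obtain ⟨M, Q, hQ, hQsum⟩ := hB (ε / 2) (half_pos hε)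
  refine ⟨Fin N ⊕ Fin M, inferInstance, Sum.elim P Q, ?_, ?_⟩
  · rw [iUnion_sum]
    exact union_subset_union hP hQ
  · rw [Fintype.sum_sum_type]
    simp only [Sum.elim_inl, Sum.elim_inr]
    linarith

theorem JordanNull.volume_eq_zero {A : Set (Fin n → ℝ)} (hA : JordanNull A) : volume A = 0 := by
  refine le_antisymm (ENNReal.le_of_forall_pos_le_add fun ε hε _ => ?_) zero_le
  obtain ⟨N, P, hP, hsum⟩ := hA ε hε
  rw [zero_add]
  calc
    volume A ≤ volume (⋃ j, (P j).toSet) := measure_mono hP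
    _ ≤ ∑ j, volume (P j).toSet := measure_iUnion_fintype_le _ _
    _ = ENNReal.ofReal (∑ j, (P j).vol) := by
      simp_rw [Brick.volume_toSet]
      rw [ENNReal.ofReal_sum_of_nonneg fun j _ => (P j).vol_nonneg]
    _ ≤ ε := by
      rw [← ENNReal.ofReal_coe_nnreal]
      exact ENNReal.ofReal_le_ofReal hsum.le

/-- A finite family of bricks can be replaced by closed bricks whose interiors cover it, at
the cost of an arbitrarily small increase of the total volume. -/
theorem exists_closed_bricks_superset {N : ℕ} (P : Fin N → Brick n) {ε : ℝ}
    (h : ∑ j, (P j).vol < ε) :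
    ∃ Q : Fin N → Brick n, (∀ j, IsClosed (Q j).toSet) ∧
      (∀ j, (P j).toSet ⊆ interior (Q j).toSet) ∧ ∑ j, (Q j).vol < ε := by
  have hη : 0 < (ε - ∑ j, (P j).vol) / (N + 1) := div_pos (sub_pos.mpr h) (by positivity)
  choose Q hQ hPQ hvol using fun j => (P j).exists_isClosed_superset hη
  refine ⟨Q, hQ, hPQ, ?_⟩
  calc
    ∑ j, (Q j).vol ≤ ∑ j, ((P j).vol + (ε - ∑ j, (P j).vol) / (N + 1)) :=
      Finset.sum_le_sum fun j _ => (hvol j).le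
    _ = ∑ j, (P j).vol + N * ((ε - ∑ j, (P j).vol) / (N + 1)) := by
      simp [Finset.sum_add_distrib]
    _ < ∑ j, (P j).vol + (N + 1) * ((ε - ∑ j, (P j).vol) / (N + 1)) := by
      linarith
    _ = ε := by
      field_simp
      ring

/-- The 2n faces of `T` are degenerate bricks of volume zero. -/
theorem jordanNull_diff_interior (T : ClosedBrick n) :
    JordanNull ((T : Set (Fin n → ℝ)) \ interior (T : Set (Fin n → ℝ))) := by
  refine .of_fintype fun ε hε => ?_
  -- The index `(i, true)` stands for the lower face in coordinate `i`, and `(i, false)` for the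
  -- upper one.
  let c : Fin n × Bool → ℝ := fun j => if j.2 then T.fst j.1 else T.snd j.1
  refine ⟨Fin n × Bool, inferInstance,
    fun j => ⟨fun i => if i = j.1 then {c j} else Icc (T.fst i) (T.snd i), fun i => ?_,
      fun i => ?_⟩, ?_, ?_⟩
  · split_ifs
    exacts [ordConnected_singleton, ordConnected_Icc]
  · split_ifs
    exacts [Bornology.isBounded_singleton, Metric.isBounded_Icc _ _]
  · rintro x ⟨hx, hxi⟩
    rw [T.interior_coe] at hxi
    simp only [Set.mem_pi, mem_univ, true_imp_iff, not_forall] at hxi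
    obtain ⟨i, hi⟩ := hxi
    have hx' : ∀ k, x k ∈ Icc (T.fst k) (T.snd k) := fun k => ⟨hx.1 k, hx.2 k⟩
    have hc : ∃ b, x i = c (i, b) := by
      by_cases h : x i = T.fst i
      · exact ⟨true, by simpa [c] using h⟩
      · refine ⟨false, ?_⟩
        simp only [c, Bool.false_eq_true, if_false]
        by_contra h'
        exact hi ⟨lt_of_le_of_ne (hx' i).1 (Ne.symm h), lt_of_le_of_ne (hx' i).2 h'⟩
    obtain ⟨b, hb⟩ := hc
    refine mem_iUnion.mpr ⟨(i, b), fun k _ => ?_⟩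
    by_cases hk : k = i
    · subst hk
      simpa using hb
    · simpa [hk] using hx' k
  · refine lt_of_eq_of_lt (Finset.sum_eq_zero fun j _ => ?_) hε
    exact Finset.prod_eq_zero (Finset.mem_univ j.1) (by simp [Measure.real])

end JordanNull

/-! ### Properties of Lebesgue indefinite integrals. -/

section IndefiniteIntegral

variable {n : ℕ} {T : ClosedBrick n} {f : (Fin n → ℝ) → ℝ} {Ψ : SubBrick T → ℝ}

theorem isLipschitz_of_setIntegral {C : ℝ}
    (hC : ∀ᵐ x ∂volume.restrict (T : Set (Fin n → ℝ)), ‖f x‖ ≤ C)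
    (hΨ : ∀ S : SubBrick T, Ψ S = ∫ x in (S.1 : Set (Fin n → ℝ)), f x) : IsLipschitz Ψ := by
  -- The almost everywhere bound `C` need not be positive, but the Lipschitz constant must be.
  refine ⟨|C| + 1, by positivity, fun S => ?_⟩
  have h := norm_setIntegral_le_of_norm_le_const_ae (μ := volume) S.1.volume_coe_ne_top.lt_top
    (ae_restrict_of_ae_restrict_of_subset (ClosedBrick.coe_subset_coe S.2) hC)
  rw [hΨ S, ← Real.norm_eq_abs]
  refine h.trans ?_
  rw [S.1.volume_real_coe]
  exact mul_le_mul_of_nonneg_right (by linarith [le_abs_self C]) S.1.vol_nonneg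

/-- Boundaries of bricks are null, so non-overlapping bricks are disjoint up to null sets. -/
theorem isFinitelyAdditive_of_setIntegral (hf : IntegrableOn f (T : Set (Fin n → ℝ)))
    (hΨ : ∀ S : SubBrick T, Ψ S = ∫ x in (S.1 : Set (Fin n → ℝ)), f x) :
    IsFinitelyAdditive Ψ := by
  intro S m P hS hd
  have hint (i : Fin m) : ((P i).1 : Set (Fin n → ℝ)) =ᵐ[volume]
      interior ((P i).1 : Set (Fin n → ℝ)) :=
    (interior_ae_eq_of_null_frontier (P i).1.volume_frontier).symm
  simp_rw [hΨ]
  rw [hS, integral_iUnion_ae (fun i => (P i).1.measurableSet_coe.nullMeasurableSet), tsum_fintype]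
  · intro i j hij
    exact (hd i j hij).aedisjoint.congr (hint i) (hint j)
  · rw [← hS]
    exact hf.mono_set (ClosedBrick.coe_subset_coe S.2)

/-- Serves both kinds of derivative: `A = univ` for the strong one, `A = directionalPart T u α` for
the directional one. A null part of `S` outside `A` is allowed because directional bricks may touch
the boundary of the orthant. -/
theorem exists_forall_abs_average_sub_lt (hf : IntegrableOn f (T : Set (Fin n → ℝ)))
    (hΨ : ∀ S : SubBrick T, Ψ S = ∫ x in (S.1 : Set (Fin n → ℝ)), f x)
    {u : Fin n → ℝ} {A : Set (Fin n → ℝ)} {t : ℝ} (ht : Tendsto f (𝓝[A] u) (𝓝 t))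
    {ε : ℝ} (hε : 0 < ε) :
    ∃ δ : ℝ, 0 < δ ∧ ∀ S : SubBrick T, 0 < S.1.vol → (S.1 : Set (Fin n → ℝ)) ⊆ Metric.ball u δ →
      volume ((S.1 : Set (Fin n → ℝ)) \ A) = 0 → |Ψ S / S.1.vol - t| < ε := by
  obtain ⟨δ, hδ, h⟩ := Metric.tendsto_nhdsWithin_nhds.mp ht (ε / 2) (half_pos hε)
  refine ⟨δ, hδ, fun S hS hSδ hSA => ?_⟩
  have hint := hf.mono_set (ClosedBrick.coe_subset_coe S.2)
  have hsub : Ψ S - t * S.1.vol = ∫ x in (S.1 : Set (Fin n → ℝ)), (f x - t) := by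
    rw [integral_sub hint (integrableOn_const S.1.volume_coe_ne_top), hΨ, setIntegral_const,
      S.1.volume_real_coe, smul_eq_mul, mul_comm]
  have hle : |Ψ S - t * S.1.vol| ≤ ε / 2 * S.1.vol := by
    rw [hsub, ← S.1.volume_real_coe, ← Real.norm_eq_abs]
    refine norm_setIntegral_le_of_norm_le_const_ae' S.1.volume_coe_ne_top.lt_top ?_
    filter_upwards [measure_eq_zero_iff_ae_notMem.mp hSA] with x hx hxS
    have hxA : x ∈ A := by
      by_contra hxA
      exact hx ⟨hxS, hxA⟩
    exact (h hxA (hSδ hxS)).le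
  have heq : Ψ S / S.1.vol - t = (Ψ S - t * S.1.vol) / S.1.vol := by
    field_simp
  rw [heq, abs_div, abs_of_pos hS, div_lt_iff₀ hS]
  nlinarith

theorem convex_directionalPart (u : Fin n → ℝ) (α : Fin n → ℤˣ) :
    Convex ℝ (directionalPart T u α) := by
  refine convex_pi fun k _ => ?_
  split_ifs
  exacts [convex_Ioc _ _, convex_Ico _ _]

theorem volume_closure_diff_directionalPart (u : Fin n → ℝ) (α : Fin n → ℤˣ) :
    volume (closure (directionalPart T u α) \ directionalPart T u α) = 0 :=
  measure_mono_null (sdiff_subset_sdiff_right interior_subset)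
    ((convex_directionalPart u α).addHaar_frontier volume)

theorem hasStrongDerivAt_of_tendsto (hf : IntegrableOn f (T : Set (Fin n → ℝ)))
    (hΨ : ∀ S : SubBrick T, Ψ S = ∫ x in (S.1 : Set (Fin n → ℝ)), f x)
    {u : Fin n → ℝ} (hu : u ∈ interior (T : Set (Fin n → ℝ))) {t : ℝ}
    (ht : Tendsto f (𝓝 u) (𝓝 t)) : HasStrongDerivAt Ψ u t := by
  refine ⟨hu, fun ε hε => ?_⟩
  obtain ⟨δ, hδ, h⟩ := exists_forall_abs_average_sub_lt hf hΨ (A := univ) (by simpa using ht) hε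
  exact ⟨δ, hδ, fun S hS hSδ => h S hS hSδ (by simp)⟩

theorem hasStrongDerivInDirAt_of_tendsto (hf : IntegrableOn f (T : Set (Fin n → ℝ)))
    (hΨ : ∀ S : SubBrick T, Ψ S = ∫ x in (S.1 : Set (Fin n → ℝ)), f x)
    {u : Fin n → ℝ} (hu : u ∈ interior (T : Set (Fin n → ℝ))) {α : Fin n → ℤˣ} {t : ℝ}
    (ht : Tendsto f (𝓝[directionalPart T u α] u) (𝓝 t)) : HasStrongDerivInDirAt Ψ u α t := by
  refine ⟨hu, fun ε hε => ?_⟩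
  obtain ⟨δ, hδ, h⟩ := exists_forall_abs_average_sub_lt hf hΨ ht hε
  refine ⟨δ, hδ, fun S hS hSδ => h S hS (hSδ.trans inter_subset_left) ?_⟩
  exact measure_mono_null (sdiff_subset_sdiff_left (hSδ.trans inter_subset_right))
    (volume_closure_diff_directionalPart u α)

end IndefiniteIntegral

/-! ### Limits of uniform limits of step functions. -/

section Limits

variable {n : ℕ}

/-- If `I` has points arbitrarily close to `a` on the right, fix one, `b`. Every `y` in `(a, b)`
lies between `b` and a point of `I` in `(a, y)`. -/
theorem Set.OrdConnected.eventually_mem_or_notMem_nhdsGT {I : Set ℝ} (hI : I.OrdConnected)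
    (a : ℝ) : (∀ᶠ y in 𝓝[>] a, y ∈ I) ∨ ∀ᶠ y in 𝓝[>] a, y ∉ I := by
  by_cases h : ∀ᶠ y in 𝓝[>] a, y ∉ I
  · exact .inr h
  have h : ∃ᶠ y in 𝓝[>] a, y ∈ I := h
  obtain ⟨b, hb, hab⟩ := (h.and_eventually self_mem_nhdsWithin).exists
  refine .inl ?_
  filter_upwards [Ioo_mem_nhdsGT hab] with y hy
  obtain ⟨c, hc, hcy⟩ := (h.and_eventually (Ioo_mem_nhdsGT hy.1)).exists
  exact hI.out hc hb ⟨hcy.2.le, hy.2.le⟩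

theorem Set.OrdConnected.eventually_mem_or_notMem_nhdsLT {I : Set ℝ} (hI : I.OrdConnected)
    (a : ℝ) : (∀ᶠ y in 𝓝[<] a, y ∈ I) ∨ ∀ᶠ y in 𝓝[<] a, y ∉ I := by
  by_cases h : ∀ᶠ y in 𝓝[<] a, y ∉ I
  · exact .inr h
  have h : ∃ᶠ y in 𝓝[<] a, y ∈ I := h
  obtain ⟨b, hb, hab⟩ := (h.and_eventually self_mem_nhdsWithin).exists
  refine .inl ?_
  filter_upwards [Ioo_mem_nhdsLT hab] with y hy
  obtain ⟨c, hc, hcy⟩ := (h.and_eventually (Ioo_mem_nhdsLT hy.2)).exists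
  exact hI.out hb hc ⟨hy.1.le, hcy.1.le⟩

/-- Approaching `u` inside the orthant moves each coordinate strictly to one side of `u k`, so the
one-dimensional dichotomy applies to every side. -/
theorem Brick.eventually_mem_or_notMem_directionalPart (P : Brick n) (T : ClosedBrick n)
    (u : Fin n → ℝ) (α : Fin n → ℤˣ) :
    (∀ᶠ x in 𝓝[directionalPart T u α] u, x ∈ P.toSet) ∨
      ∀ᶠ x in 𝓝[directionalPart T u α] u, x ∉ P.toSet := by
  have hside k : (∀ᶠ x in 𝓝[directionalPart T u α] u, x k ∈ P.side k) ∨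
      ∀ᶠ x in 𝓝[directionalPart T u α] u, x k ∉ P.side k := by
    have hcont : Tendsto (fun x : Fin n → ℝ => x k) (𝓝[directionalPart T u α] u) (𝓝 (u k)) :=
      (continuous_apply k).continuousAt.tendsto.mono_left nhdsWithin_le_nhds
    by_cases hα : α k = 1
    · have : Tendsto (fun x : Fin n → ℝ => x k) (𝓝[directionalPart T u α] u) (𝓝[>] (u k)) := by
        refine tendsto_nhdsWithin_iff.mpr ⟨hcont, ?_⟩
        filter_upwards [self_mem_nhdsWithin] with x hx
        have := hx k trivial
        simp only [hα, if_true] at this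
        exact this.1
      exact ((P.ordConnected_side k).eventually_mem_or_notMem_nhdsGT (u k)).imp
        this.eventually this.eventually
    · have : Tendsto (fun x : Fin n → ℝ => x k) (𝓝[directionalPart T u α] u) (𝓝[<] (u k)) := by
        refine tendsto_nhdsWithin_iff.mpr ⟨hcont, ?_⟩
        filter_upwards [self_mem_nhdsWithin] with x hx
        have := hx k trivial
        simp only [hα, if_false] at this
        exact this.2
      exact ((P.ordConnected_side k).eventually_mem_or_notMem_nhdsLT (u k)).imp
        this.eventually this.eventually
  by_cases h : ∀ k, ∀ᶠ x in 𝓝[directionalPart T u α] u, x k ∈ P.side k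
  · left
    filter_upwards [eventually_all.mpr h] with x hx k _ using hx k
  · right
    rw [not_forall] at h
    obtain ⟨k, hk⟩ := h
    filter_upwards [(hside k).resolve_left hk] with x hx hxP using hx (hxP k trivial)

theorem eventually_mem_or_notMem_of_notMem_frontier {X : Type*} [TopologicalSpace X] {A : Set X}
    {u : X} (hu : u ∉ frontier A) : (∀ᶠ x in 𝓝 u, x ∈ A) ∨ ∀ᶠ x in 𝓝 u, x ∉ A := by
  by_cases h : u ∈ closure A
  · left
    have : u ∈ interior A := by
      by_contra h'
      exact hu ⟨h, h'⟩
    exact mem_interior_iff_mem_nhds.mp this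
  · right
    filter_upwards [isClosed_closure.isOpen_compl.mem_nhds h] with x hx hxA
    exact hx (subset_closure hxA)

theorem StepFunction.eventually_eq_const {T : Set (Fin n → ℝ)} (g : StepFunction T)
    {F : Filter (Fin n → ℝ)}
    (h : ∀ j, (∀ᶠ x in F, x ∈ (g.brick j).toSet) ∨ ∀ᶠ x in F, x ∉ (g.brick j).toSet) :
    ∃ c, ∀ᶠ x in F, g.toFun x = c := by
  have hj j : ∃ c, ∀ᶠ x in F, (g.brick j).toSet.indicator (fun _ => g.coeff j) x = c := by
    rcases h j with h | h
    · exact ⟨g.coeff j, h.mono fun x hx => by simp [hx]⟩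
    · exact ⟨0, h.mono fun x hx => by simp [hx]⟩
  choose c hc using hj
  refine ⟨∑ j, c j, ?_⟩
  filter_upwards [eventually_all.mpr hc] with x hx
  exact Finset.sum_congr rfl fun j _ => hx j

/-- The image filter is Cauchy: `f` is uniformly close to some `g m`, which is eventually constant.
-/
theorem exists_tendsto_of_tendstoUniformlyOn {X : Type*} {g : ℕ → X → ℝ} {f : X → ℝ}
    {V : Set X} (h : TendstoUniformlyOn g f atTop V) {F : Filter X} (hV : V ∈ F)
    (hg : ∀ m, ∃ c, ∀ᶠ x in F, g m x = c) : ∃ t, Tendsto f F (𝓝 t) := by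
  rcases F.eq_or_neBot with rfl | hF
  · exact ⟨0, tendsto_bot⟩
  refine cauchy_map_iff_exists_tendsto.mp (Metric.cauchy_iff.mpr ⟨inferInstance, fun ε hε => ?_⟩)
  obtain ⟨m, hm⟩ := (Metric.tendstoUniformlyOn_iff.mp h (ε / 2) (half_pos hε)).exists
  obtain ⟨c, hc⟩ := hg m
  refine ⟨Metric.ball c (ε / 2), ?_, fun x hx y hy => ?_⟩
  · rw [mem_map]
    filter_upwards [hc, hV] with x hx hxV
    simpa [hx] using hm x hxV
  · have := dist_triangle_right x y c
    rw [Metric.mem_ball] at hx hy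
    linarith

/-- Nearly uniform convergence is uniform near every point off a Jordan null set. -/
theorem NearlyUniform.jordanNull {T : ClosedBrick n} {g : ℕ → (Fin n → ℝ) → ℝ}
    {f : (Fin n → ℝ) → ℝ} (h : NearlyUniform (T : Set (Fin n → ℝ)) g f) :
    JordanNull {u | u ∈ T ∧ ¬ (u ∈ interior (T : Set (Fin n → ℝ)) ∧
      ∃ V ∈ 𝓝 u, TendstoUniformlyOn g f atTop V)} := by
  have : JordanNull {u | u ∈ interior (T : Set (Fin n → ℝ)) ∧
      ¬ ∃ V ∈ 𝓝 u, TendstoUniformlyOn g f atTop V} := by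
    intro ε hε
    obtain ⟨N, P, -, hsum, hunif⟩ := h.2 ε hε
    -- The closed enlargements have an open complement, so a point outside them has a whole
    -- neighbourhood on which the convergence is uniform.
    obtain ⟨Q, hQc, hPQ, hQsum⟩ := exists_closed_bricks_superset P hsum
    refine ⟨N, Q, fun u hu => ?_, hQsum⟩
    by_contra huQ
    refine hu.2 ⟨_, inter_mem (isOpen_interior.mem_nhds hu.1)
      ((isClosed_iUnion_of_finite hQc).isOpen_compl.mem_nhds huQ), hunif.mono ?_⟩
    exact inter_subset_inter interior_subset
      (compl_subset_compl.mpr (iUnion_mono fun j => (hPQ j).trans interior_subset))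
  refine ((jordanNull_diff_interior T).union this).mono ?_
  rintro u ⟨huT, hu⟩
  by_cases hui : u ∈ interior (T : Set (Fin n → ℝ))
  · exact .inr ⟨hui, fun hV => hu ⟨hui, hV⟩⟩
  · exact .inl ⟨huT, hui⟩

end Limits

/-! ### Necessity of the four conditions. -/

theorem IsIndefiniteKIntegral.lipschitz_additive_differentiable {n : ℕ}
    {T : ClosedBrick n} {Ψ : SubBrick T → ℝ}
    {f : (Fin n → ℝ) → ℝ} (h : IsIndefiniteKIntegral T f Ψ) :
    IsLipschitz Ψ ∧ IsFinitelyAdditive Ψ ∧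
      volume {u | u ∈ T ∧ ¬ ∃ t : ℝ, HasStrongDerivAt Ψ u t} = 0 ∧
      JordanNull {u | u ∈ T ∧
        ∃ α : Fin n → ℤˣ, ¬ ∃ t : ℝ, HasStrongDerivInDirAt Ψ u α t} := by
  obtain ⟨hK, h⟩ := h
  have hΨ (S : SubBrick T) : Ψ S = ∫ x in (S.1 : Set (Fin n → ℝ)), f x :=
    ((hasKIntegralOn_iff S.1.measurableSet_coe S.1.volume_coe_ne_top).mp (h S)).2
  have hf := hK.integrableOn T.measurableSet_coe T.volume_coe_ne_top
  obtain ⟨C, hC⟩ := hK.exists_bound T.measurableSet_coe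
  obtain ⟨g, hg⟩ := hK
  refine ⟨isLipschitz_of_setIntegral hC hΨ, isFinitelyAdditive_of_setIntegral hf hΨ, ?_, ?_⟩
  -- A countable union of brick boundaries is Lebesgue null, though it may be dense.
  · have hZ : volume (⋃ m, ⋃ j, frontier ((g m).brick j).toSet) = 0 :=
      measure_iUnion_null fun m => measure_iUnion_null fun j =>
        ((g m).brick j).convex_toSet.addHaar_frontier volume
    refine measure_mono_null ?_ (measure_union_null hg.jordanNull.volume_eq_zero hZ)
    rintro u ⟨huT, hu⟩
    by_contra huc
    simp only [mem_union, not_or, mem_ofPred_eq, huT, true_and, not_not, mem_iUnion,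
      not_exists] at huc
    obtain ⟨⟨hui, V, hV, hunif⟩, hfr⟩ := huc
    obtain ⟨t, ht⟩ := exists_tendsto_of_tendstoUniformlyOn hunif hV fun m =>
      (g m).eventually_eq_const fun j => eventually_mem_or_notMem_of_notMem_frontier (hfr m j)
    exact hu ⟨t, hasStrongDerivAt_of_tendsto hf hΨ hui ht⟩
  · refine hg.jordanNull.mono ?_
    rintro u ⟨huT, α, hu⟩
    refine ⟨huT, fun ⟨hui, V, hV, hunif⟩ => hu ?_⟩
    obtain ⟨t, ht⟩ := exists_tendsto_of_tendstoUniformlyOn hunif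
      (mem_nhdsWithin_of_mem_nhds hV) fun m => (g m).eventually_eq_const fun j =>
        ((g m).brick j).eventually_mem_or_notMem_directionalPart T u α
    exact ⟨t, hasStrongDerivInDirAt_of_tendsto hf hΨ hui ht⟩

/-! ### The derivative in direction (1, …, 1). -/

section CornerDerivative

variable {n : ℕ} {T : ClosedBrick n} {Ψ : SubBrick T → ℝ}

/-- Ensures that the differentiability conditions are never vacuous, so that bounds and uniqueness
can be read off from an actual brick. -/
theorem exists_subBrick_of_mem_nhds {u : Fin n → ℝ} (hu : u ∈ interior (T : Set (Fin n → ℝ)))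
    {O : Set (Fin n → ℝ)} (hO : O ∈ 𝓝 u) :
    ∃ S : SubBrick T, 0 < S.1.vol ∧ (S.1 : Set (Fin n → ℝ)) ⊆ O ∧
      ∀ y ∈ (S.1 : Set (Fin n → ℝ)), u ≤ y := by
  obtain ⟨r, hr, hsub⟩ := Metric.mem_nhds_iff.mp
    (inter_mem hO (mem_interior_iff_mem_nhds.mp hu))
  let S : ClosedBrick n := ⟨(u, fun i => u i + r / 2), fun i => by simpa using (half_pos hr).le⟩
  have hS : (S : Set (Fin n → ℝ)) ⊆ Metric.ball u r := by
    rintro y ⟨h1, h2⟩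
    refine (dist_pi_lt_iff hr).mpr fun i => ?_
    have h1 := h1 i
    have h2 := h2 i
    simp only [S] at h1 h2
    rw [Real.dist_eq, abs_lt]
    constructor <;> linarith
  refine ⟨⟨S, NonemptyInterval.coe_subset_coe.mp fun y hy => (hsub (hS hy)).2⟩, ?_,
    fun y hy => (hsub (hS hy)).1, fun y hy => hy.1⟩
  rw [ClosedBrick.vol_eq]
  exact Finset.prod_pos fun i _ => by simpa [S] using hr

theorem mem_closure_directionalPart {u : Fin n → ℝ}
    (hu : u ∈ interior (T : Set (Fin n → ℝ))) {α : Fin n → ℤˣ} {y : Fin n → ℝ}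
    (hyT : y ∈ (T : Set (Fin n → ℝ)))
    (hy : ∀ k, if α k = 1 then u k ≤ y k else y k ≤ u k) :
    y ∈ closure (directionalPart T u α) := by
  rw [T.interior_coe] at hu
  rw [directionalPart, closure_pi_set]
  intro k _
  have huk := hu k trivial
  have hyk := hy k
  beta_reduce
  split_ifs at hyk ⊢ with h
  · rw [closure_Ioc huk.2.ne]
    exact ⟨hyk, hyT.2 k⟩
  · rw [closure_Ico huk.1.ne]
    exact ⟨hyT.1 k, hyk⟩

theorem HasStrongDerivInDirAt.exists_subBrick {u : Fin n → ℝ} {t : ℝ}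
    (h : HasStrongDerivInDirAt Ψ u (fun _ => 1) t) {O : Set (Fin n → ℝ)} (hO : O ∈ 𝓝 u)
    {ε : ℝ} (hε : 0 < ε) :
    ∃ S : SubBrick T, 0 < S.1.vol ∧ (S.1 : Set (Fin n → ℝ)) ⊆ O ∧
      (∀ y ∈ (S.1 : Set (Fin n → ℝ)), u ≤ y) ∧ |Ψ S / S.1.vol - t| < ε := by
  obtain ⟨δ, hδ, hd⟩ := h.2 ε hε
  obtain ⟨S, hS, hSO, huS⟩ := exists_subBrick_of_mem_nhds h.1
    (inter_mem hO (Metric.ball_mem_nhds u hδ))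
  refine ⟨S, hS, hSO.trans inter_subset_left, huS, hd S hS fun y hy => ⟨(hSO hy).2, ?_⟩⟩
  exact mem_closure_directionalPart h.1 (ClosedBrick.coe_subset_coe S.2 hy)
    fun k => by simpa using huS y hy k

theorem HasStrongDerivInDirAt.abs_le {u : Fin n → ℝ} {t L : ℝ}
    (h : HasStrongDerivInDirAt Ψ u (fun _ => 1) t)
    (hL : ∀ S : SubBrick T, |Ψ S| ≤ L * S.1.vol) : |t| ≤ L := by
  refine le_of_forall_pos_lt_add fun ε hε => ?_
  obtain ⟨S, hS, -, -, hSε⟩ := h.exists_subBrick univ_mem hε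
  have h1 : |Ψ S / S.1.vol| ≤ L := by
    rw [abs_div, abs_of_pos hS]
    exact (div_le_iff₀ hS).mpr (hL S)
  have h2 := abs_sub_abs_le_abs_sub t (Ψ S / S.1.vol)
  rw [abs_sub_comm] at h2
  linarith

theorem HasStrongDerivAt.eq_of_hasStrongDerivInDirAt {u : Fin n → ℝ} {t s : ℝ}
    (ht : HasStrongDerivAt Ψ u t) (hs : HasStrongDerivInDirAt Ψ u (fun _ => 1) s) : s = t := by
  refine eq_of_forall_dist_le fun ε hε => ?_
  obtain ⟨δ, hδ, hd⟩ := ht.2 (ε / 2) (half_pos hε)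
  obtain ⟨S, hS, hSO, -, hSε⟩ := hs.exists_subBrick (Metric.ball_mem_nhds u hδ) (half_pos hε)
  have h1 := hd S hS hSO
  rw [abs_sub_comm] at hSε
  have h2 := abs_sub_le s (Ψ S / S.1.vol) t
  rw [Real.dist_eq]
  linarith

theorem HasStrongDerivAt.hasStrongDerivInDirAt {u : Fin n → ℝ} {t : ℝ}
    (h : HasStrongDerivAt Ψ u t) (α : Fin n → ℤˣ) : HasStrongDerivInDirAt Ψ u α t :=
  ⟨h.1, fun ε hε =>
    let ⟨δ, hδ, hd⟩ := h.2 ε hε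
    ⟨δ, hδ, fun S hS hSδ => hd S hS (hSδ.trans inter_subset_left)⟩⟩

/-- Near `u`, the corner derivative at a point in the half-open orthant of `u` with direction `α`
is close to the derivative at `u` in direction `α`. -/
theorem HasStrongDerivInDirAt.exists_abs_sub_lt {u : Fin n → ℝ} {α : Fin n → ℤˣ} {t : ℝ}
    (h : HasStrongDerivInDirAt Ψ u α t) {ε : ℝ} (hε : 0 < ε) :
    ∃ δ, 0 < δ ∧ ∀ x ∈ Metric.ball u δ, (∀ k, α k = 1 ↔ u k ≤ x k) →
      ∀ s, HasStrongDerivInDirAt Ψ x (fun _ => 1) s → |s - t| < ε := by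
  obtain ⟨δ, hδ, hd⟩ := h.2 (ε / 2) (half_pos hε)
  refine ⟨δ, hδ, fun x hx hα s hs => ?_⟩
  -- A brick with lowest corner `x` only extends upwards, so coordinates with `u k ≤ x k` stay on
  -- their side. The neighbourhood has to keep the other coordinates from crossing `u k`.
  have hO : Metric.ball u δ ∩ {y | ∀ k, x k < u k → y k < u k} ∈ 𝓝 x := by
    refine inter_mem (Metric.isOpen_ball.mem_nhds hx) (eventually_all.mpr fun k => ?_)
    by_cases hk : x k < u k
    · filter_upwards [(continuous_apply k).continuousAt.eventually_lt_const hk] with y hy _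
        using hy
    · exact .of_forall fun y hy => absurd hy hk
  obtain ⟨S, hS, hSO, hxS, hSε⟩ := hs.exists_subBrick hO (half_pos hε)
  have h1 := hd S hS fun y hy => ⟨(hSO hy).1, mem_closure_directionalPart h.1
    (ClosedBrick.coe_subset_coe S.2 hy) fun k => ?_⟩
  · rw [abs_sub_comm] at hSε
    have h2 := abs_sub_le s (Ψ S / S.1.vol) t
    linarith
  · split_ifs with hk
    · exact ((hα k).mp hk).trans (hxS y hy k)
    · exact ((hSO hy).2 k (not_le.mp fun hle => hk ((hα k).mpr hle))).le

end CornerDerivative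

/-! ### Uniform approximation by step functions and K-integrability. -/

section Approximation

variable {n : ℕ}

/-- Every step function bounded by `L` can be modified so that it is `ε`-close to `f` on `K ∩ s`,
without spoiling this closeness elsewhere on `K`. -/
def Patchable (T K : Set (Fin n → ℝ)) (f : (Fin n → ℝ) → ℝ) (L ε : ℝ)
    (s : Set (Fin n → ℝ)) : Prop :=
  ∀ h₀, IsStep T h₀ → (∀ x, |h₀ x| ≤ L) → ∃ h, IsStep T h ∧ (∀ x, |h x| ≤ L) ∧
    (∀ x ∈ K ∩ s, |h x - f x| ≤ ε) ∧ ∀ x ∈ K, |h₀ x - f x| ≤ ε → |h x - f x| ≤ ε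

namespace Patchable

variable {T K : Set (Fin n → ℝ)} {f : (Fin n → ℝ) → ℝ} {L ε : ℝ}

theorem empty : Patchable T K f L ε ∅ := fun h₀ hs hL => ⟨h₀, hs, hL, by simp, fun _ _ h => h⟩

theorem mono {s t : Set (Fin n → ℝ)} (hst : s ⊆ t) (ht : Patchable T K f L ε t) :
    Patchable T K f L ε s := fun h₀ hs hL =>
  let ⟨h, h1, h2, h3, h4⟩ := ht h₀ hs hL
  ⟨h, h1, h2, fun x hx => h3 x ⟨hx.1, hst hx.2⟩, h4⟩

/-- The last clause of `Patchable` is made for this: patching on `t` keeps what was achieved on `s`.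
-/
theorem union {s t : Set (Fin n → ℝ)} (hs : Patchable T K f L ε s) (ht : Patchable T K f L ε t) :
    Patchable T K f L ε (s ∪ t) := by
  intro h₀ h0s h0L
  obtain ⟨h₁, h1s, h1L, h1, h1'⟩ := hs h₀ h0s h0L
  obtain ⟨h₂, h2s, h2L, h2, h2'⟩ := ht h₁ h1s h1L
  refine ⟨h₂, h2s, h2L, ?_, fun x hx hx0 => h2' x hx (h1' x hx hx0)⟩
  rintro x ⟨hxK, hx | hx⟩
  · exact h2' x hxK (h1 x ⟨hxK, hx⟩)
  · exact h2 x ⟨hxK, hx⟩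

theorem iUnion {ι : Type*} [Finite ι] {s : ι → Set (Fin n → ℝ)}
    (hs : ∀ i, Patchable T K f L ε (s i)) : Patchable T K f L ε (⋃ i, s i) := by
  have (I : Set ι) (hI : I.Finite) : Patchable T K f L ε (⋃ i ∈ I, s i) := by
    induction I, hI using Set.Finite.induction_on with
    | empty => simpa using empty
    | insert _ _ ih =>
      rw [biUnion_insert]
      exact (hs _).union ih
  simpa using this univ finite_univ

/-- The function is overwritten on `P` by one value of `f` on `K ∩ P`, or by `0` if that set is
empty. -/
theorem of_brick {P : Brick n} (hP : P.toSet ⊆ T) (hL : 0 ≤ L) (hf : ∀ x ∈ K, |f x| ≤ L)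
    (hosc : ∀ x ∈ K ∩ P.toSet, ∀ y ∈ K ∩ P.toSet, |f x - f y| ≤ ε) :
    Patchable T K f L ε P.toSet := by
  classical
  intro h₀ h0s h0L
  obtain ⟨c, hcL, hc⟩ : ∃ c, |c| ≤ L ∧ ∀ x ∈ K ∩ P.toSet, |c - f x| ≤ ε := by
    rcases (K ∩ P.toSet).eq_empty_or_nonempty with h | ⟨x, hx⟩
    · exact ⟨0, by simpa using hL, by simp [h]⟩
    · exact ⟨f x, hf x hx.1, hosc x hx⟩
  refine ⟨P.toSet.piecewise (fun _ => c) h₀, h0s.piecewise_const hP c, fun x => ?_,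
    fun x hx => ?_, fun x hx hx0 => ?_⟩
  · by_cases hxP : x ∈ P.toSet
    · simpa [hxP] using hcL
    · simpa [hxP] using h0L x
  · simpa [hx.2] using hc x hx
  · by_cases hxP : x ∈ P.toSet
    · simpa [hxP] using hc x ⟨hx, hxP⟩
    · simpa [hxP] using hx0

end Patchable

variable {T : ClosedBrick n} {Ψ : SubBrick T → ℝ} {f : (Fin n → ℝ) → ℝ}

/-- The part in `T` of the half-open orthant at `u` with direction `α`, cut off at distance `δ`. -/
def orthantBrick (T : ClosedBrick n) (u : Fin n → ℝ) (δ : ℝ) (α : Fin n → ℤˣ) : Brick n where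
  side k := Icc (T.fst k) (T.snd k) ∩
    (Ioo (u k - δ) (u k + δ) ∩ if α k = 1 then Ici (u k) else Iio (u k))
  ordConnected_side k := by
    refine ordConnected_Icc.inter (ordConnected_Ioo.inter ?_)
    split_ifs
    exacts [ordConnected_Ici, ordConnected_Iio]
  isBounded_side k := (Metric.isBounded_Icc _ _).subset inter_subset_left

theorem mem_orthantBrick {u x : Fin n → ℝ} {δ : ℝ} (hδ : 0 < δ) {α : Fin n → ℤˣ} :
    x ∈ (orthantBrick T u δ α).toSet ↔
      x ∈ (T : Set (Fin n → ℝ)) ∧ x ∈ Metric.ball u δ ∧ ∀ k, α k = 1 ↔ u k ≤ x k := by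
  have h1 : x ∈ (T : Set (Fin n → ℝ)) ↔ ∀ k, x k ∈ Icc (T.fst k) (T.snd k) := by
    rw [NonemptyInterval.coe_def, ← pi_univ_Icc, mem_univ_pi]
  have h2 : x ∈ Metric.ball u δ ↔ ∀ k, x k ∈ Ioo (u k - δ) (u k + δ) := by
    simp_rw [Metric.mem_ball, dist_pi_lt_iff hδ, ← Metric.mem_ball, Real.ball_eq_Ioo]
  have h3 k : (α k = 1 ↔ u k ≤ x k) ↔ x k ∈ if α k = 1 then Ici (u k) else Iio (u k) := by
    by_cases hk : α k = 1 <;> simp [hk]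
  rw [h1, h2]
  simp_rw [h3, ← forall_and]
  exact mem_univ_pi

/-- By compactness it is enough to patch near a single `u`. There 2ⁿ half-open orthant bricks cover
a neighbourhood in `K`, and on each of them `f` stays within `ε / 2` of one directional derivative
at `u`. -/
theorem exists_step_approximation {K : Set (Fin n → ℝ)} (hK : IsCompact K)
    (hKT : K ⊆ (T : Set (Fin n → ℝ)))
    (hd : ∀ u ∈ K, ∀ α, ∃ t, HasStrongDerivInDirAt Ψ u α t)
    (hf : ∀ u ∈ K, HasStrongDerivInDirAt Ψ u (fun _ => 1) (f u))
    {L : ℝ} (hL0 : 0 ≤ L) (hL : ∀ S : SubBrick T, |Ψ S| ≤ L * S.1.vol) {ε : ℝ} (hε : 0 < ε) :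
    ∃ h, IsStep (T : Set (Fin n → ℝ)) h ∧ (∀ x, |h x| ≤ L) ∧ ∀ x ∈ K, |h x - f x| ≤ ε := by
  have hfL : ∀ x ∈ K, |f x| ≤ L := fun x hx => (hf x hx).abs_le hL
  have key : Patchable (T : Set (Fin n → ℝ)) K f L ε K := by
    refine hK.induction_on (p := Patchable (T : Set (Fin n → ℝ)) K f L ε) .empty
      (fun s t hst ht => ht.mono hst) (fun s t hs ht => hs.union ht)
      fun u hu => ?_
    choose t ht using hd u hu
    choose δ hδ hδt using fun α => (ht α).exists_abs_sub_lt (half_pos hε)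
    refine ⟨K ∩ ⋂ α, Metric.ball u (δ α), inter_mem self_mem_nhdsWithin
      (mem_nhdsWithin_of_mem_nhds (iInter_mem.mpr fun α => Metric.ball_mem_nhds u (hδ α))), ?_⟩
    refine Patchable.mono (t := ⋃ α, (orthantBrick T u (δ α) α).toSet) ?_ (.iUnion fun α => ?_)
    · rintro x ⟨hxK, hx⟩
      rw [mem_iInter] at hx
      refine mem_iUnion.mpr ⟨fun k => if u k ≤ x k then 1 else -1,
        (mem_orthantBrick (hδ _)).mpr ⟨hKT hxK, hx _, fun k => ?_⟩⟩
      by_cases hk : u k ≤ x k <;> simp [hk]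
    · refine .of_brick (fun x hx => ((mem_orthantBrick (hδ α)).mp hx).1) hL0 hfL ?_
      have hclose : ∀ x ∈ K ∩ (orthantBrick T u (δ α) α).toSet, |f x - t α| < ε / 2 := by
        rintro x ⟨hxK, hx⟩
        obtain ⟨-, hx1, hx2⟩ := (mem_orthantBrick (hδ α)).mp hx
        exact hδt α x hx1 hx2 _ (hf x hxK)
      intro x hx y hy
      have h1 := hclose x hx
      have h2 := hclose y hy
      rw [abs_sub_comm] at h2
      have h3 := abs_sub_le (f x) (t α) (f y)
      linarith
  obtain ⟨h, h1, h2, h3, -⟩ := key 0 .zero (by simpa using hL0)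
  exact ⟨h, h1, h2, fun x hx => h3 x ⟨hx, hx⟩⟩

/-- Removing open neighbourhoods of `A` of volume below `1 / (k + 1)` from `T` leaves compact sets
`K k`. The step function `g m` is chosen `1 / (m + 1)`-close to `f` on `K 0 ∪ … ∪ K m`, so the
convergence is uniform on every `K k`. The union is needed because the `K k` need not be nested. -/
theorem kIntegrableOn_of_hasStrongDerivInDirAt {A : Set (Fin n → ℝ)} (hA : JordanNull A)
    (hd : ∀ u ∈ (T : Set (Fin n → ℝ)) \ A, ∀ α, ∃ t, HasStrongDerivInDirAt Ψ u α t)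
    (hf : ∀ u ∈ (T : Set (Fin n → ℝ)) \ A, HasStrongDerivInDirAt Ψ u (fun _ => 1) (f u))
    (hΨ : IsLipschitz Ψ) : KIntegrableOn (T : Set (Fin n → ℝ)) f := by
  obtain ⟨L, hL0, hL⟩ := hΨ
  have hcover (k : ℕ) : ∃ K : Set (Fin n → ℝ), IsCompact K ∧ K ⊆ (T : Set (Fin n → ℝ)) \ A ∧
      ∃ (N : ℕ) (P : Fin N → Brick n), (∀ j, (P j).toSet ⊆ (T : Set (Fin n → ℝ))) ∧
        ∑ j, (P j).vol < 1 / ((k : ℝ) + 1) ∧ (T : Set (Fin n → ℝ)) \ ⋃ j, (P j).toSet ⊆ K := by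
    obtain ⟨N, P, hAP, hsum⟩ := hA (1 / ((k : ℝ) + 1)) Nat.one_div_pos_of_nat
    obtain ⟨Q, -, hPQ, hQsum⟩ := exists_closed_bricks_superset P hsum
    refine ⟨(T : Set (Fin n → ℝ)) \ ⋃ j, interior (Q j).toSet,
      T.isCompact_coe.diff (isOpen_iUnion fun j => isOpen_interior),
      sdiff_subset_sdiff_right (hAP.trans (iUnion_mono hPQ)), N, fun j => (Q j).inter T.toBrick,
      fun j => ?_, (Finset.sum_le_sum fun j _ => (Q j).vol_inter_le _).trans_lt hQsum, ?_⟩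
    · rw [Brick.toSet_inter, T.toSet_toBrick]
      exact inter_subset_right
    · simp_rw [Brick.toSet_inter, T.toSet_toBrick]
      rintro x ⟨hxT, hx⟩
      refine ⟨hxT, fun hxQ => hx ?_⟩
      obtain ⟨j, hj⟩ := mem_iUnion.mp hxQ
      exact mem_iUnion.mpr ⟨j, interior_subset hj, hxT⟩
  choose K hK hKA hKP using hcover
  have happrox (m : ℕ) : ∃ g : StepFunction (T : Set (Fin n → ℝ)), (∀ x, |g.toFun x| ≤ L) ∧
      ∀ k ≤ m, ∀ x ∈ K k, |g.toFun x - f x| ≤ 1 / ((m : ℝ) + 1) := by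
    have hsub : ⋃ k ∈ Iic m, K k ⊆ (T : Set (Fin n → ℝ)) \ A := iUnion₂_subset fun k _ => hKA k
    obtain ⟨_, ⟨g, rfl⟩, h1, h2⟩ := exists_step_approximation (f := f) (ε := 1 / ((m : ℝ) + 1))
      ((finite_Iic m).isCompact_biUnion fun k _ => hK k) (hsub.trans sdiff_subset)
      (fun u hu => hd u (hsub hu)) (fun u hu => hf u (hsub hu)) hL0.le hL
      Nat.one_div_pos_of_nat
    exact ⟨g, h1, fun k hk x hx => h2 x (mem_iUnion₂.mpr ⟨k, hk, hx⟩)⟩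
  choose g hgL hg using happrox
  refine ⟨g, ⟨L, fun m x _ => hgL m x⟩, fun δ hδ => ?_⟩
  obtain ⟨k, hk⟩ := exists_nat_one_div_lt hδ
  obtain ⟨N, P, hPT, hsum, hsub⟩ := hKP k
  refine ⟨N, P, hPT, hsum.trans hk, Metric.tendstoUniformlyOn_iff.mpr fun ε hε => ?_⟩
  obtain ⟨m₀, hm₀⟩ := exists_nat_one_div_lt hε
  filter_upwards [eventually_ge_atTop (max k m₀)] with m hm x hx
  rw [dist_comm, Real.dist_eq]
  refine (hg m k ((le_max_left _ _).trans hm) x (hsub hx)).trans_lt (lt_of_le_of_lt ?_ hm₀)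
  exact Nat.one_div_le_one_div ((le_max_right _ _).trans hm)

end Approximation

/-! ### Division of a brick into congruent cells. -/

section Grid

/-- The left endpoint of the `j`-th of `N` intervals of equal length dividing `[a, b]`. -/
noncomputable def gridPoint (a b : ℝ) (N j : ℕ) : ℝ := a + j * ((b - a) / N)

variable {a b : ℝ} {N : ℕ}

theorem gridPoint_zero : gridPoint a b N 0 = a := by simp [gridPoint]

theorem gridPoint_self (hN : 0 < N) : gridPoint a b N N = b := by
  have : (N : ℝ) ≠ 0 := by positivity
  rw [gridPoint, mul_div_cancel₀ _ this, add_sub_cancel]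

theorem monotone_gridPoint (hab : a ≤ b) : Monotone (gridPoint a b N) := by
  intro i j hij
  have : 0 ≤ (b - a) / N := div_nonneg (sub_nonneg.mpr hab) N.cast_nonneg
  exact add_le_add_right (mul_le_mul_of_nonneg_right (by exact_mod_cast hij) this) a

theorem gridPoint_succ_sub (j : ℕ) :
    gridPoint a b N (j + 1) - gridPoint a b N j = (b - a) / N := by
  rw [gridPoint, gridPoint]
  push_cast
  ring

theorem exists_mem_Ico_gridPoint {x : ℝ} (hN : 0 < N) (hx : x ∈ Ico a b) :
    ∃ j : Fin N, x ∈ Ico (gridPoint a b N j) (gridPoint a b N (j + 1)) := by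
  by_contra! h
  -- If no cell contains `x`, then passing from one grid point to the next shows that all of them,
  -- including `b`, are at most `x`.
  have key : ∀ j ≤ N, gridPoint a b N j ≤ x := by
    intro j
    induction j with
    | zero => exact fun _ => gridPoint_zero.trans_le hx.1
    | succ j ih =>
      intro hj
      by_contra hlt
      exact h ⟨j, hj⟩ ⟨ih (by lia), not_le.mp hlt⟩
  have := key N le_rfl
  rw [gridPoint_self hN] at this
  exact this.not_gt hx.2

theorem exists_mem_Icc_gridPoint {x : ℝ} (hN : 0 < N) (hx : x ∈ Icc a b) :
    ∃ j : Fin N, x ∈ Icc (gridPoint a b N j) (gridPoint a b N (j + 1)) := by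
  rcases hx.2.lt_or_eq with h | rfl
  · obtain ⟨j, hj⟩ := exists_mem_Ico_gridPoint hN ⟨hx.1, h⟩
    exact ⟨j, Ico_subset_Icc_self hj⟩
  · refine ⟨⟨N - 1, by lia⟩, ?_, ?_⟩
    · exact (monotone_gridPoint hx.1 (Nat.sub_le N 1)).trans (gridPoint_self hN).le
    · rw [Nat.sub_add_cancel hN, gridPoint_self hN]

theorem gridPoint_lt_injective (hab : a ≤ b) {x : ℝ} {i j : ℕ}
    (hi : gridPoint a b N i ≤ x ∧ x < gridPoint a b N (i + 1))
    (hj : gridPoint a b N j ≤ x ∧ x < gridPoint a b N (j + 1)) : i = j := by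
  have h1 := (monotone_gridPoint hab).reflect_lt (hi.1.trans_lt hj.2)
  have h2 := (monotone_gridPoint hab).reflect_lt (hj.1.trans_lt hi.2)
  lia

variable {n : ℕ}

/-- The cell with index `v` of the division of `S` into `Nⁿ` congruent bricks. -/
noncomputable def gridCell (S : ClosedBrick n) (N : ℕ) (v : Fin n → Fin N) : ClosedBrick n :=
  ⟨(fun i => gridPoint (S.fst i) (S.snd i) N (v i),
    fun i => gridPoint (S.fst i) (S.snd i) N (v i + 1)),
    fun i => monotone_gridPoint (S.fst_le_snd i) (Nat.le_succ _)⟩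

theorem gridCell_le (S : ClosedBrick n) (hN : 0 < N) (v : Fin n → Fin N) : gridCell S N v ≤ S := by
  refine ⟨fun i => ?_, fun i => ?_⟩
  · exact gridPoint_zero.symm.trans_le (monotone_gridPoint (S.fst_le_snd i) (Nat.zero_le _))
  · exact (monotone_gridPoint (S.fst_le_snd i) (v i).2).trans (gridPoint_self hN).le

theorem vol_gridCell (S : ClosedBrick n) (v : Fin n → Fin N) :
    (gridCell S N v).vol = ∏ i, (S.snd i - S.fst i) / N := by
  rw [ClosedBrick.vol_eq]
  exact Finset.prod_congr rfl fun i _ => gridPoint_succ_sub _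

theorem vol_gridCell_pos {S : ClosedBrick n} (hS : 0 < S.vol) (hN : 0 < N) (v : Fin n → Fin N) :
    0 < (gridCell S N v).vol := by
  rw [vol_gridCell, Finset.prod_div_distrib, ← ClosedBrick.vol_eq]
  exact div_pos hS (Finset.prod_pos fun _ _ => by exact_mod_cast hN)

theorem coe_eq_iUnion_gridCell (S : ClosedBrick n) (hN : 0 < N) :
    (S : Set (Fin n → ℝ)) = ⋃ v, (gridCell S N v : Set (Fin n → ℝ)) := by
  refine Subset.antisymm (fun x hx => ?_)
    (iUnion_subset fun v => ClosedBrick.coe_subset_coe (gridCell_le S hN v))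
  choose v hv using fun i => exists_mem_Icc_gridPoint hN ⟨hx.1 i, hx.2 i⟩
  exact mem_iUnion.mpr ⟨v, fun i => (hv i).1, fun i => (hv i).2⟩

theorem disjoint_interior_gridCell (S : ClosedBrick n) {v w : Fin n → Fin N} (hvw : v ≠ w) :
    Disjoint (interior (gridCell S N v : Set (Fin n → ℝ)))
      (interior (gridCell S N w : Set (Fin n → ℝ))) := by
  rw [ClosedBrick.interior_coe, ClosedBrick.interior_coe, Set.disjoint_left]
  refine fun x hv hw => hvw (funext fun i => Fin.ext ?_)
  exact gridPoint_lt_injective (S.fst_le_snd i) ⟨(hv i trivial).1.le, (hv i trivial).2⟩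
    ⟨(hw i trivial).1.le, (hw i trivial).2⟩

/-- The half-open cell with index `v`. -/
def gridIco (S : ClosedBrick n) (N : ℕ) (v : Fin n → Fin N) : Set (Fin n → ℝ) :=
  Set.univ.pi fun i => Ico ((gridCell S N v).fst i) ((gridCell S N v).snd i)

theorem gridIco_subset (S : ClosedBrick n) (v : Fin n → Fin N) :
    gridIco S N v ⊆ (gridCell S N v : Set (Fin n → ℝ)) :=
  fun _ hx => ⟨fun i => (hx i trivial).1, fun i => (hx i trivial).2.le⟩

theorem eq_of_mem_gridIco {S : ClosedBrick n} {v w : Fin n → Fin N} {x : Fin n → ℝ}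
    (hv : x ∈ gridIco S N v) (hw : x ∈ gridIco S N w) : v = w :=
  funext fun i => Fin.ext (gridPoint_lt_injective (S.fst_le_snd i) (hv i trivial) (hw i trivial))

theorem measurableSet_gridIco (S : ClosedBrick n) (v : Fin n → Fin N) :
    MeasurableSet (gridIco S N v) :=
  MeasurableSet.univ_pi fun _ => measurableSet_Ico

theorem volume_real_gridIco (S : ClosedBrick n) (v : Fin n → Fin N) :
    volume.real (gridIco S N v) = (gridCell S N v).vol := by
  rw [← ClosedBrick.volume_real_coe, NonemptyInterval.coe_def]
  exact measureReal_congr Measure.univ_pi_Ico_ae_eq_Icc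

/-- Only points on the upper faces of `S` are missed, and these are the same for every `N`. -/
theorem ae_exists_mem_gridIco (S : ClosedBrick n) :
    ∀ᵐ x ∂volume.restrict (S : Set (Fin n → ℝ)), ∀ N, 0 < N → ∃ v, x ∈ gridIco S N v := by
  have : (Set.univ.pi fun i => Ico (S.fst i) (S.snd i)) =ᵐ[volume] (S : Set (Fin n → ℝ)) := by
    rw [NonemptyInterval.coe_def]
    exact Measure.univ_pi_Ico_ae_eq_Icc
  rw [← Measure.restrict_congr_set this]
  filter_upwards [ae_restrict_mem (MeasurableSet.univ_pi fun _ => measurableSet_Ico)] with x hx N hN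
  choose v hv using fun i => exists_mem_Ico_gridPoint hN (hx i trivial)
  exact ⟨v, fun i _ => hv i⟩

/-- For large `N`, all cells of the division of `S` containing `x` are close to `x`. -/
theorem eventually_gridCell_subset_ball (S : ClosedBrick n) {δ : ℝ} (hδ : 0 < δ) :
    ∀ᶠ N : ℕ in atTop, ∀ v : Fin n → Fin N, ∀ x ∈ (gridCell S N v : Set (Fin n → ℝ)),
      (gridCell S N v : Set (Fin n → ℝ)) ⊆ Metric.ball x δ := by
  have h : ∀ᶠ N : ℕ in atTop, ∀ i, (S.snd i - S.fst i) / (N : ℝ) < δ :=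
    eventually_all.mpr fun i =>
      (tendsto_const_div_atTop_nhds_zero_nat _).eventually_lt_const hδ
  filter_upwards [h] with N hN v x hx y hy
  refine (dist_pi_lt_iff hδ).mpr fun i => (Real.dist_le_of_mem_Icc ⟨hy.1 i, hy.2 i⟩
    ⟨hx.1 i, hx.2 i⟩).trans_lt (lt_of_eq_of_lt (gridPoint_succ_sub _) (hN i))

end Grid

/-! ### Recovering `Ψ` from its derivative, and sufficiency. -/

section Representation

variable {n : ℕ} {T : ClosedBrick n} {Ψ : SubBrick T → ℝ} {f : (Fin n → ℝ) → ℝ}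

theorem IsFinitelyAdditive.sum_fintype (hΨ : IsFinitelyAdditive Ψ) {ι : Type*} [Fintype ι]
    (S : SubBrick T) (P : ι → SubBrick T)
    (hS : (S.1 : Set (Fin n → ℝ)) = ⋃ i, ((P i).1 : Set (Fin n → ℝ)))
    (hP : ∀ i j, i ≠ j → Disjoint (interior ((P i).1 : Set (Fin n → ℝ)))
      (interior ((P j).1 : Set (Fin n → ℝ)))) : Ψ S = ∑ i, Ψ (P i) := by
  let e := Fintype.equivFin ι
  rw [hΨ S _ (fun j => P (e.symm j)) ?_ fun i j hij => hP _ _ (e.symm.injective.ne hij)]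
  · exact Equiv.sum_comp e.symm fun i => Ψ (P i)
  · rw [hS, e.symm.surjective.iUnion_comp fun i => ((P i).1 : Set (Fin n → ℝ))]

/-- A finitely additive Lipschitz set function is the Lebesgue integral of its strong
derivative. -/
theorem setIntegral_eq_of_ae_hasStrongDerivAt (hL : IsLipschitz Ψ) (hΨ : IsFinitelyAdditive Ψ)
    (hf : ∀ᵐ u ∂volume.restrict (T : Set (Fin n → ℝ)), HasStrongDerivAt Ψ u (f u))
    (S : SubBrick T) : ∫ x in (S.1 : Set (Fin n → ℝ)), f x = Ψ S := by
  obtain ⟨L, -, hL⟩ := hL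
  -- For a degenerate `S` both sides vanish; the averages below need cells of positive volume.
  rcases S.1.vol_nonneg.eq_or_lt' with hS | hS
  · have h1 : volume (S.1 : Set (Fin n → ℝ)) = 0 := by
      rwa [← S.1.volume_real_coe, measureReal_eq_zero_iff S.1.volume_coe_ne_top] at hS
    have h2 : Ψ S = 0 := by simpa [hS] using hL S
    rw [h2, Measure.restrict_eq_zero.mpr h1, integral_zero_measure]
  have hle (m : ℕ) (v) : gridCell S.1 (m + 1) v ≤ T := (gridCell_le S.1 m.succ_pos v).trans S.2
  let Q (m : ℕ) (v : Fin n → Fin (m + 1)) : SubBrick T := ⟨gridCell S.1 (m + 1) v, hle m v⟩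
  -- The averages of `Ψ` over the cells. Half-open cells make the values unambiguous, and `m + 1`
  -- avoids a division into zero parts.
  let φ (m : ℕ) (x : Fin n → ℝ) : ℝ :=
    ∑ v, (gridIco S.1 (m + 1) v).indicator (fun _ => Ψ (Q m v) / (Q m v).1.vol) x
  have hφ {m : ℕ} {v} {x} (hx : x ∈ gridIco S.1 (m + 1) v) :
      φ m x = Ψ (Q m v) / (Q m v).1.vol := by
    refine (Finset.sum_eq_single v (fun w _ hw => ?_) (by simp)).trans (indicator_of_mem hx _)
    exact indicator_of_notMem (fun hxw => hw (eq_of_mem_gridIco hxw hx)) _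
  have hpos (m : ℕ) (v) : 0 < (Q m v).1.vol := vol_gridCell_pos hS m.succ_pos v
  have hint (m : ℕ) : ∫ x in (S.1 : Set (Fin n → ℝ)), φ m x = Ψ S := by
    rw [hΨ.sum_fintype S (Q m) (coe_eq_iUnion_gridCell S.1 m.succ_pos)
      fun v w hvw => disjoint_interior_gridCell S.1 hvw]
    have : IsFiniteMeasure (volume.restrict (S.1 : Set (Fin n → ℝ))) :=
      isFiniteMeasure_restrict.mpr S.1.volume_coe_ne_top
    rw [integral_finsetSum _ fun v _ =>
      (integrable_const _).indicator (measurableSet_gridIco S.1 v)]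
    refine Finset.sum_congr rfl fun v _ => ?_
    have hsub : gridIco S.1 (m + 1) v ⊆ (S.1 : Set (Fin n → ℝ)) :=
      (gridIco_subset S.1 v).trans (ClosedBrick.coe_subset_coe (gridCell_le S.1 m.succ_pos v))
    rw [integral_indicator (measurableSet_gridIco S.1 v), setIntegral_const,
      measureReal_restrict_apply (measurableSet_gridIco S.1 v), inter_eq_left.mpr hsub,
      volume_real_gridIco, smul_eq_mul, mul_div_cancel₀ _ (hpos m v).ne']
  have hlim : Tendsto (fun m => ∫ x in (S.1 : Set (Fin n → ℝ)), φ m x) atTop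
      (𝓝 (∫ x in (S.1 : Set (Fin n → ℝ)), f x)) := by
    refine tendsto_integral_of_dominated_convergence (fun _ => L) (fun m => ?_)
      (integrableOn_const S.1.volume_coe_ne_top) (fun m => ?_) ?_
    · exact (Finset.measurable_sum _ fun v _ => measurable_const.indicator
        (measurableSet_gridIco S.1 v)).aestronglyMeasurable
    · filter_upwards [ae_exists_mem_gridIco S.1] with x hx
      obtain ⟨v, hv⟩ := hx (m + 1) m.succ_pos
      rw [hφ hv, Real.norm_eq_abs, abs_div, abs_of_pos (hpos m v), div_le_iff₀ (hpos m v)]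
      exact hL (Q m v)
    · filter_upwards [ae_exists_mem_gridIco S.1, ae_restrict_of_ae_restrict_of_subset
        (ClosedBrick.coe_subset_coe S.2) hf] with x hx hfx
      refine Metric.tendsto_atTop'.mpr fun ε hε => ?_
      obtain ⟨δ, hδ, hd⟩ := hfx.2 ε hε
      obtain ⟨N, hN⟩ := eventually_atTop.mp (eventually_gridCell_subset_ball S.1 hδ)
      refine ⟨N, fun m hm => ?_⟩
      obtain ⟨v, hv⟩ := hx (m + 1) m.succ_pos
      rw [hφ hv]
      exact hd (Q m v) (hpos m v) (hN (m + 1) (by lia) v x (gridIco_subset S.1 v hv))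
  simp_rw [hint] at hlim
  exact (tendsto_nhds_unique hlim tendsto_const_nhds)

open Classical in
/-- The strong derivative in direction `(1, …, 1)`, where it exists, and `0` elsewhere. -/
noncomputable def cornerDeriv (Ψ : SubBrick T → ℝ) (u : Fin n → ℝ) : ℝ :=
  if h : ∃ t, HasStrongDerivInDirAt Ψ u (fun _ => 1) t then h.choose else 0

theorem hasStrongDerivInDirAt_cornerDeriv {u : Fin n → ℝ}
    (h : ∃ t, HasStrongDerivInDirAt Ψ u (fun _ => 1) t) :
    HasStrongDerivInDirAt Ψ u (fun _ => 1) (cornerDeriv Ψ u) := by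
  rw [cornerDeriv, dif_pos h]
  exact h.choose_spec

/-- The directional condition makes `cornerDeriv Ψ` K-integrable. Almost everywhere it agrees with
the strong derivative, so its integral over `S` is `Ψ S`. -/
theorem isIndefiniteKIntegral_cornerDeriv (hL : IsLipschitz Ψ) (hΨ : IsFinitelyAdditive Ψ)
    (hd : volume {u | u ∈ T ∧ ¬ ∃ t : ℝ, HasStrongDerivAt Ψ u t} = 0)
    (hdir : JordanNull {u | u ∈ T ∧
      ∃ α : Fin n → ℤˣ, ¬ ∃ t : ℝ, HasStrongDerivInDirAt Ψ u α t}) :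
    IsIndefiniteKIntegral T (cornerDeriv Ψ) Ψ := by
  have hall : ∀ u ∈ (T : Set (Fin n → ℝ)) \ {u | u ∈ T ∧
      ∃ α : Fin n → ℤˣ, ¬ ∃ t : ℝ, HasStrongDerivInDirAt Ψ u α t},
      ∀ α, ∃ t, HasStrongDerivInDirAt Ψ u α t := by
    rintro u ⟨huT, hu⟩ α
    by_contra h
    exact hu ⟨huT, α, h⟩
  have hK := kIntegrableOn_of_hasStrongDerivInDirAt hdir hall
    (fun u hu => hasStrongDerivInDirAt_cornerDeriv (hall u hu _)) hL
  have hae : ∀ᵐ u ∂volume.restrict (T : Set (Fin n → ℝ)),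
      HasStrongDerivAt Ψ u (cornerDeriv Ψ u) := by
    rw [ae_restrict_iff' T.measurableSet_coe]
    filter_upwards [measure_eq_zero_iff_ae_notMem.mp hd] with u hu huT
    obtain ⟨t, ht⟩ : ∃ t, HasStrongDerivAt Ψ u t := by
      by_contra h
      exact hu ⟨huT, h⟩
    rwa [ht.eq_of_hasStrongDerivInDirAt
      (hasStrongDerivInDirAt_cornerDeriv ⟨t, ht.hasStrongDerivInDirAt _⟩)]
  refine ⟨hK, fun S => (hasKIntegralOn_iff S.1.measurableSet_coe S.1.volume_coe_ne_top).mpr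
    ⟨?_, (setIntegral_eq_of_ae_hasStrongDerivAt hL hΨ hae S).symm⟩⟩
  have := hK.mono_brick S.1.toBrick (by
    rw [S.1.toSet_toBrick]
    exact ClosedBrick.coe_subset_coe S.2)
  rwa [S.1.toSet_toBrick] at this

end Representation

theorem theorem5p4 (n : ℕ) (hn : 0 < n) (T : ClosedBrick n) (Ψ : SubBrick T → ℝ) :
    (∃ f : (Fin n → ℝ) → ℝ, IsIndefiniteKIntegral T f Ψ) ↔
      (IsLipschitz Ψ ∧
        IsFinitelyAdditive Ψ ∧
        volume {u | u ∈ T ∧ ¬ ∃ t : ℝ, HasStrongDerivAt Ψ u t} = 0 ∧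
        JordanNull {u | u ∈ T ∧
          ∃ α : Fin n → ℤˣ, ¬ ∃ t : ℝ, HasStrongDerivInDirAt Ψ u α t}) :=
  ⟨fun ⟨_, h⟩ => h.lipschitz_additive_differentiable, fun ⟨hL, hΨ, hd, hdir⟩ =>
    ⟨cornerDeriv Ψ, isIndefiniteKIntegral_cornerDeriv hL hΨ hd hdir⟩⟩
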